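/- Let $\mathcal P_d$ be the set of $d\times d$ permutation matrices, let $\|\cdot\|_F$ be the Frobenius norm, and let all quantities $p,d\in\mathbb N$, $\lambda^*\in\mathbb R$, $Z_1^*,\dots,Z_p^*\in\mathcal P_d$ and $\eta$ be allowed to vary along a sequence. One observes $Y=\lambda^*Z^*Z^{*T}+W\in\mathbb R^{pd\times pd}$, where $Z^{*T}=(Z_1^{*T},\dots,Z_p^{*T})\in\mathbb R^{d\times pd}$, and the $d\times d$ blocks of $W$ satisfy $W_{ij}=W_{ji}^T$ and $W_{ii}=0$, while the $W_{ij}$ with $i<j$ are independent with i.i.d. $\mathcal N(0,1)$ entries. Let $Y_j\in\mathbb R^{pd\times d}$ be the $j$-th block column of $Y$. From a (possibly data-dependent) initialization $Z^{(0)}=(Z^{(0)}_1,\dots,Z^{(0)}_p)\in\mathcal P_d^p$, stacked in the same way, iterate for $t\ge1$ $$B^{(t)}\in\operatorname*{argmin}_{B=\lambda Z^{(t-1)},\ \lambda\in\mathbb R}\|Y-Z^{(t-1)}B^T\|_F^2,\qquad Z_j^{(t)}\in\operatorname*{argmin}_{U\in\mathcal P_d}\|Y_j-B^{(t)}U^T\|_F^2\quad(1\le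 j\le p),$$ with ties broken arbitrarily. Let $\ell(Z,Z^*)=p\lambda^{*2}\sum_{j=1}^p\|Z_j-Z_j^*\|_F^2$. Assume $\frac{p\lambda^{*2}}{d\log d}\to\infty$ (with $d\geq 2$), and suppose that for some sequence $\varepsilon\to0$ we have $\ell(Z^{(0)},Z^*)\le\varepsilon\,p^2\lambda^{*2}$ with probability at least $1-\eta$. Then there is a sequence $\delta\to0$, depending only on the sequences $p,d,\lambda^*,\varepsilon$, such that, for all sufficiently large indices in the sequence, with probability at least $1-\eta-\exp(-\sqrt{p\lambda^{*2}})-e^{-pd}$, $$\ell(Z^{(t)},Z^*)\le p\exp\left(-(1+\delta)\frac{p\lambda^{*2}}{2}\right)+\frac12\,\ell(Z^{(t-1)},Z^*)\qquad\text{for all }t\ge1.$$ -/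

import Mathlib

open MeasureTheory ProbabilityTheory Filter Topology

namespace PermSync

/-- The squared Frobenius norm of a real matrix. -/
def frobSq {m n : Type*} [Fintype m] [Fintype n] (A : Matrix m n ℝ) : ℝ :=
  ∑ i, ∑ j, A i j ^ 2

/-- The `pd × d` matrix obtained by stacking the permutation matrices of
`Z 1, …, Z p` on top of each other. Rows are indexed by (block, row inside the block). -/
def stack {p d : ℕ} (Z : Fin p → Equiv.Perm (Fin d)) : Matrix (Fin p × Fin d) (Fin d) ℝ :=
  Matrix.of fun r b => (Z r.1).permMatrix ℝ r.2 b

/-- The observation `Y = λ Z Zᵀ + W`. -/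
def observation {p d : ℕ} (lam : ℝ) (Z : Fin p → Equiv.Perm (Fin d))
    (W : Matrix (Fin p × Fin d) (Fin p × Fin d) ℝ) :
    Matrix (Fin p × Fin d) (Fin p × Fin d) ℝ :=
  lam • (stack Z * (stack Z).transpose) + W

/-- The `j`-th block column `Y_j` (of size `pd × d`) of a `pd × pd` matrix `Y`. -/
def blockCol {p d : ℕ} (Y : Matrix (Fin p × Fin d) (Fin p × Fin d) ℝ) (j : Fin p) :
    Matrix (Fin p × Fin d) (Fin d) ℝ :=
  Matrix.of fun r b => Y r (j, b)

/-- The noise: `W_{ij}`, `i < j`, are independent `d × d` blocks with i.i.d. standard Gaussian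
entries, `W_{ij} = W_{ji}ᵀ`, and `W_{ii} = 0`. -/
structure IsGaussianNoise {Ω : Type*} [MeasurableSpace Ω] {p d : ℕ}
    (W : Ω → Matrix (Fin p × Fin d) (Fin p × Fin d) ℝ) (μ : Measure Ω) : Prop where
  symm : ∀ ω i j a b, W ω (i, a) (j, b) = W ω (j, b) (i, a)
  diag : ∀ ω i a b, W ω (i, a) (i, b) = 0
  law : ∀ i j, i < j → ∀ a b, HasLaw (fun ω => W ω (i, a) (j, b)) (gaussianReal 0 1) μ
  indep : iIndepFun
    (fun (q : {q : Fin p × Fin p // q.1 < q.2} × Fin d × Fin d) (ω : Ω) =>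
      W ω (q.1.1.1, q.2.1) (q.1.1.2, q.2.2)) μ

/-- The parameter space `{λ Z : λ ∈ ℝ}`. -/
def paramSpace {p d : ℕ} (Z : Fin p → Equiv.Perm (Fin d)) :
    Set (Matrix (Fin p × Fin d) (Fin d) ℝ) :=
  {B | ∃ c : ℝ, B = c • stack Z}

/-- One step of the algorithm: `Z'` is a possible successor of `Z` given the data `Y`. First `B`
minimizes `‖Y - Z Bᵀ‖²` over `{λ Z}`, then every `Z'_j` minimizes `‖Y_j - B Uᵀ‖²` over the
permutation matrices `U`. Ties may be broken in any way. -/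
def IsStep {p d : ℕ} (Y : Matrix (Fin p × Fin d) (Fin p × Fin d) ℝ)
    (Z Z' : Fin p → Equiv.Perm (Fin d)) : Prop :=
  ∃ B ∈ paramSpace Z,
    (∀ B' ∈ paramSpace Z,
      frobSq (Y - stack Z * B.transpose) ≤ frobSq (Y - stack Z * B'.transpose)) ∧
    ∀ (j : Fin p) (U : Equiv.Perm (Fin d)),
      frobSq (blockCol Y j - B * ((Z' j).permMatrix ℝ).transpose) ≤
        frobSq (blockCol Y j - B * (U.permMatrix ℝ).transpose)

/-- The loss `ℓ(Z, Z*) = p λ² ∑ⱼ ‖Z_j - Z*_j‖²`. -/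
noncomputable def loss {p d : ℕ} (lam : ℝ) (Z Zstar : Fin p → Equiv.Perm (Fin d)) : ℝ :=
  p * lam ^ 2 * ∑ j, frobSq ((Z j).permMatrix ℝ - (Zstar j).permMatrix ℝ)

end PermSync

/-! Put D_j = Z'_j - Z*_j. Once the fitted scale has the sign of λ, optimality of Z'_j against Z*_j
says that the noise in the direction Z D_jᵀ outweighs a signal gap close to |λ| p ‖D_j‖²/2. Split
this noise along Z = Z* + (Z - Z*).

The Z* part (`IdealError`) does not involve the iterate. For each candidate it is a Gaussian of
variance at most p ‖D_j‖², and ‖D_j‖² ≥ 4 for distinct permutations, which produces the exponent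
pλ²/2. The total cost of such errors, `idealLoss`, is controlled by Markov's inequality.

The Z - Z* part depends on the data through Z. Summed over j it is bilinear in Z - Z* and U - Z*,
with variance at most twice the product of the two squared errors, so `CrossError` can be excluded
by a union bound over all pairs (Z, U): the entropy 2 p d log d is beaten by κ² p · pλ². Outside
that event, errors not charged to `idealLoss` amount to at most half of the previous error. The sign
of the scale (`ScaleError`) is also handled uniformly in Z.

No exceptional event refers to t or to the initialization. Hence the contraction `errSq_step_le` is
deterministic and applies at every t, as long as the iterates stay in the ball `errSq ≤ κ p`. -/

namespace PermSync

/-! ### Frobenius inner product and norm -/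

section Matrices

variable {m n : Type*} [Fintype m] [Fintype n]

/-- The Frobenius inner product. -/
def matInner (A B : Matrix m n ℝ) : ℝ := ∑ i, ∑ j, A i j * B i j

lemma matInner_add_left (A B C : Matrix m n ℝ) :
    matInner (A + B) C = matInner A C + matInner B C := by
  simp [matInner, add_mul, Finset.sum_add_distrib]

lemma matInner_smul_left (c : ℝ) (A B : Matrix m n ℝ) :
    matInner (c • A) B = c * matInner A B := by
  simp [matInner, Finset.mul_sum, mul_assoc]

lemma matInner_add_right (A B C : Matrix m n ℝ) :
    matInner A (B + C) = matInner A B + matInner A C := by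
  simp [matInner, mul_add, Finset.sum_add_distrib]

lemma matInner_sub_right (A B C : Matrix m n ℝ) :
    matInner A (B - C) = matInner A B - matInner A C := by
  simp [matInner, mul_sub, Finset.sum_sub_distrib]

lemma matInner_smul_right (c : ℝ) (A B : Matrix m n ℝ) :
    matInner A (c • B) = c * matInner A B := by
  simp [matInner, Finset.mul_sum, mul_left_comm]

lemma matInner_sum_right {ι : Type*} (s : Finset ι) (A : Matrix m n ℝ) (B : ι → Matrix m n ℝ) :
    matInner A (∑ k ∈ s, B k) = ∑ k ∈ s, matInner A (B k) := by
  classical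
  induction s using Finset.induction_on with
  | empty => simp [matInner]
  | insert a s ha ih => rw [Finset.sum_insert ha, Finset.sum_insert ha, matInner_add_right, ih]

lemma frobSq_nonneg (A : Matrix m n ℝ) : 0 ≤ frobSq A :=
  Finset.sum_nonneg fun _ _ => Finset.sum_nonneg fun _ _ => sq_nonneg _

@[simp] lemma frobSq_zero : frobSq (0 : Matrix m n ℝ) = 0 := by simp [frobSq]

lemma frobSq_smul (c : ℝ) (A : Matrix m n ℝ) : frobSq (c • A) = c ^ 2 * frobSq A := by
  simp [frobSq, Finset.mul_sum, mul_pow]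

lemma frobSq_sub_smul (A B : Matrix m n ℝ) (c : ℝ) :
    frobSq (A - c • B) = frobSq A - 2 * c * matInner A B + c ^ 2 * frobSq B := by
  simp only [frobSq, matInner, Finset.mul_sum, ← Finset.sum_sub_distrib, ← Finset.sum_add_distrib]
  refine Finset.sum_congr rfl fun i _ => Finset.sum_congr rfl fun j _ => ?_
  simp only [Matrix.sub_apply, Matrix.smul_apply, smul_eq_mul]
  ring

lemma frobSq_sub_le (A B : Matrix m n ℝ) :
    frobSq (A - B) ≤ 2 * frobSq A + 2 * frobSq B := by
  simp only [frobSq, Finset.mul_sum, ← Finset.sum_add_distrib]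
  refine Finset.sum_le_sum fun i _ => Finset.sum_le_sum fun j _ => ?_
  simp only [Matrix.sub_apply]
  nlinarith [sq_nonneg (A i j + B i j)]

lemma frobSq_transpose (A : Matrix m n ℝ) : frobSq A.transpose = frobSq A := by
  simp only [frobSq, Matrix.transpose_apply]
  exact Finset.sum_comm

end Matrices

/-! ### Distances between permutation matrices -/

section Permutations

variable {d : ℕ}

lemma permMatrix_entry (σ : Equiv.Perm (Fin d)) (a b : Fin d) :
    σ.permMatrix ℝ a b = if σ a = b then 1 else 0 := by
  simp [Equiv.Perm.permMatrix, PEquiv.toMatrix_apply, Equiv.toPEquiv_apply, eq_comm]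

lemma sum_permMatrix (σ : Equiv.Perm (Fin d)) : ∑ a, ∑ b, σ.permMatrix ℝ a b = d := by
  simp

lemma permMatrix_mul_transpose (σ τ : Equiv.Perm (Fin d)) :
    σ.permMatrix ℝ * (τ.permMatrix ℝ).transpose = (τ⁻¹ * σ).permMatrix ℝ := by
  rw [Matrix.transpose_permMatrix, Matrix.permMatrix_mul]

lemma frobSq_permMatrix (σ : Equiv.Perm (Fin d)) : frobSq (σ.permMatrix ℝ) = d := by
  simp [frobSq]

lemma frobSq_permMatrix_mul (σ : Equiv.Perm (Fin d)) (A : Matrix (Fin d) (Fin d) ℝ) :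
    frobSq (σ.permMatrix ℝ * A) = frobSq A := by
  rw [Equiv.Perm.permMatrix, PEquiv.toMatrix_toPEquiv_mul]
  simp only [frobSq, Matrix.submatrix_apply, id]
  exact Equiv.sum_comp σ fun i => ∑ j, A i j ^ 2

/-- Since r, s, t are 0 or 1, r(s - t) is at most the positive part ((s - t)² + (s - t))/2, and the
entries of a difference of permutation matrices sum to zero. -/
lemma matInner_permMatrix_sub_le (ρ σ τ : Equiv.Perm (Fin d)) :
    matInner (ρ.permMatrix ℝ) (σ.permMatrix ℝ - τ.permMatrix ℝ) ≤
      frobSq (σ.permMatrix ℝ - τ.permMatrix ℝ) / 2 := by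
  have h : ∑ a, ∑ b, (σ.permMatrix ℝ - τ.permMatrix ℝ) a b = 0 := by
    simp only [Matrix.sub_apply, Finset.sum_sub_distrib, sum_permMatrix, sub_self]
  have h2 : frobSq (σ.permMatrix ℝ - τ.permMatrix ℝ) / 2 =
      ∑ a, ∑ b, ((σ.permMatrix ℝ - τ.permMatrix ℝ) a b ^ 2 / 2 +
        (σ.permMatrix ℝ - τ.permMatrix ℝ) a b / 2) := by
    simp only [Finset.sum_add_distrib, ← Finset.sum_div, h, frobSq]
    simp
  rw [h2]
  refine Finset.sum_le_sum fun a _ => Finset.sum_le_sum fun b _ => ?_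
  simp only [Matrix.sub_apply, permMatrix_entry]
  split_ifs <;> norm_num

lemma matInner_permMatrix_sub_self (σ τ : Equiv.Perm (Fin d)) :
    matInner (τ.permMatrix ℝ) (σ.permMatrix ℝ - τ.permMatrix ℝ) =
      -(frobSq (σ.permMatrix ℝ - τ.permMatrix ℝ) / 2) := by
  have h : ∑ a, ∑ b, (σ.permMatrix ℝ - τ.permMatrix ℝ) a b = 0 := by
    simp only [Matrix.sub_apply, Finset.sum_sub_distrib, sum_permMatrix, sub_self]
  have h2 : -(frobSq (σ.permMatrix ℝ - τ.permMatrix ℝ) / 2) =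
      ∑ a, ∑ b, (-((σ.permMatrix ℝ - τ.permMatrix ℝ) a b ^ 2 / 2) +
        (σ.permMatrix ℝ - τ.permMatrix ℝ) a b / 2) := by
    simp only [Finset.sum_add_distrib, ← Finset.sum_div, h, frobSq, Finset.sum_neg_distrib]
    simp
  rw [h2]
  refine Finset.sum_congr rfl fun a _ => Finset.sum_congr rfl fun b _ => ?_
  simp only [Matrix.sub_apply, permMatrix_entry]
  split_ifs <;> norm_num

lemma sum_row_permMatrix_sub_sq (σ τ : Equiv.Perm (Fin d)) (a : Fin d) :
    ∑ b, (σ.permMatrix ℝ - τ.permMatrix ℝ) a b ^ 2 = if σ a = τ a then 0 else 2 := by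
  simp only [Matrix.sub_apply, permMatrix_entry]
  split_ifs with h
  · simp [h]
  · have : ∀ b, ((if σ a = b then (1 : ℝ) else 0) - if τ a = b then 1 else 0) ^ 2 =
        (if σ a = b then 1 else 0) + if τ a = b then 1 else 0 := by
      intro b
      split_ifs with h1 h2
      · exact absurd (h1.trans h2.symm) h
      all_goals norm_num
    simp only [this, Finset.sum_add_distrib, Finset.sum_ite_eq, Finset.mem_univ, if_true]
    norm_num

lemma frobSq_permMatrix_sub_le (σ τ : Equiv.Perm (Fin d)) :
    frobSq (σ.permMatrix ℝ - τ.permMatrix ℝ) ≤ 2 * d := by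
  simp only [frobSq, sum_row_permMatrix_sub_sq]
  calc _ ≤ ∑ _a : Fin d, (2 : ℝ) := Finset.sum_le_sum fun a _ => by split_ifs <;> norm_num
    _ = 2 * d := by simp [mul_comm]

/-- Two permutations cannot differ at exactly one point, and each row where they differ contributes
2. This 4 fixes the constant in the final exponent. -/
lemma four_le_frobSq_permMatrix_sub {σ τ : Equiv.Perm (Fin d)} (h : σ ≠ τ) :
    4 ≤ frobSq (σ.permMatrix ℝ - τ.permMatrix ℝ) := by
  obtain ⟨a, ha⟩ : ∃ a, σ a ≠ τ a := by
    by_contra! hc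
    exact h (Equiv.ext hc)
  set b := τ⁻¹ (σ a) with hb
  have hτb : τ b = σ a := by simp [hb]
  have hab : a ≠ b := fun e => ha (by rw [← hτb, ← e])
  have hbσ : σ b ≠ τ b := fun e => hab (σ.injective (by rw [e, hτb]))
  simp only [frobSq, sum_row_permMatrix_sub_sq]
  calc (4 : ℝ) = ∑ c ∈ {a, b}, (if σ c = τ c then (0 : ℝ) else 2) := by
        rw [Finset.sum_pair hab, if_neg ha, if_neg hbσ]; norm_num
    _ ≤ _ := Finset.sum_le_sum_of_subset_of_nonneg (Finset.subset_univ _)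
        fun c _ _ => by split_ifs <;> norm_num

end Permutations

/-! ### Block structure and the signal terms -/

section Blocks

variable {p d : ℕ}

/-- The `k`-th block of rows of a `pd × d` matrix. -/
def rowBlock (A : Matrix (Fin p × Fin d) (Fin d) ℝ) (k : Fin p) : Matrix (Fin d) (Fin d) ℝ :=
  Matrix.of fun a b => A (k, a) b

/-- The `pd × d` matrix whose `j`-th block of rows is `D` and whose other blocks vanish. -/
def singleBlock (j : Fin p) (D : Matrix (Fin d) (Fin d) ℝ) : Matrix (Fin p × Fin d) (Fin d) ℝ :=
  Matrix.of fun r b => if r.1 = j then D r.2 b else 0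

lemma rowBlock_stack (Z : Fin p → Equiv.Perm (Fin d)) (k : Fin p) :
    rowBlock (stack Z) k = (Z k).permMatrix ℝ := rfl

lemma rowBlock_sub (A B : Matrix (Fin p × Fin d) (Fin d) ℝ) (k : Fin p) :
    rowBlock (A - B) k = rowBlock A k - rowBlock B k := rfl

lemma rowBlock_singleBlock (j k : Fin p) (D : Matrix (Fin d) (Fin d) ℝ) :
    rowBlock (singleBlock j D) k = if k = j then D else 0 := by
  ext a b
  by_cases h : k = j <;> simp [rowBlock, singleBlock, h]

lemma mul_transpose_apply_block (A B : Matrix (Fin p × Fin d) (Fin d) ℝ) (i k : Fin p)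
    (a b : Fin d) :
    (A * B.transpose) (i, a) (k, b) = (rowBlock A i * (rowBlock B k).transpose) a b := rfl

lemma matInner_mul_transpose (A B C D : Matrix (Fin p × Fin d) (Fin d) ℝ) :
    matInner (A * B.transpose) (C * D.transpose) = ∑ i, ∑ k,
      matInner (rowBlock A i * (rowBlock B k).transpose)
        (rowBlock C i * (rowBlock D k).transpose) := by
  simp only [matInner, Fintype.sum_prod_type, mul_transpose_apply_block]
  exact Finset.sum_congr rfl fun i _ => Finset.sum_comm

lemma frobSq_mul_transpose (A B : Matrix (Fin p × Fin d) (Fin d) ℝ) :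
    frobSq (A * B.transpose) = ∑ i, ∑ k,
      frobSq (rowBlock A i * (rowBlock B k).transpose) := by
  simp only [frobSq, Fintype.sum_prod_type, mul_transpose_apply_block]
  exact Finset.sum_congr rfl fun i _ => Finset.sum_comm

lemma matInner_mul_singleBlock_transpose (Y : Matrix (Fin p × Fin d) (Fin p × Fin d) ℝ)
    (A : Matrix (Fin p × Fin d) (Fin d) ℝ) (j : Fin p) (D : Matrix (Fin d) (Fin d) ℝ) :
    matInner Y (A * (singleBlock j D).transpose) =
      matInner (blockCol Y j) (A * D.transpose) := by
  simp only [matInner]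
  refine Finset.sum_congr rfl fun r _ => ?_
  rw [Fintype.sum_prod_type, Finset.sum_eq_single j]
  · refine Finset.sum_congr rfl fun b _ => ?_
    simp [blockCol, Matrix.mul_apply, singleBlock]
  · intro k _ hk
    refine Finset.sum_eq_zero fun b _ => ?_
    simp [Matrix.mul_apply, singleBlock, hk]
  · simp

lemma frobSq_stack_mul_transpose (Z Z' : Fin p → Equiv.Perm (Fin d)) :
    frobSq (stack Z * (stack Z').transpose) = p ^ 2 * d := by
  simp only [frobSq_mul_transpose, rowBlock_stack, permMatrix_mul_transpose, frobSq_permMatrix]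
  simp
  ring

lemma frobSq_stack_mul_permMatrix_transpose (Z : Fin p → Equiv.Perm (Fin d))
    (σ : Equiv.Perm (Fin d)) :
    frobSq (stack Z * (σ.permMatrix ℝ).transpose) = p * d := by
  have : ∀ i, ∑ a, ∑ b, (stack Z * (σ.permMatrix ℝ).transpose) (i, a) b ^ 2 = d := by
    intro i
    rw [← frobSq_permMatrix (σ⁻¹ * Z i), ← permMatrix_mul_transpose]
    rfl
  rw [frobSq, Fintype.sum_prod_type, Finset.sum_congr rfl fun i _ => this i]
  simp

lemma frobSq_stack_mul_singleBlock_transpose (Z : Fin p → Equiv.Perm (Fin d)) (j : Fin p)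
    (D : Matrix (Fin d) (Fin d) ℝ) :
    frobSq (stack Z * (singleBlock j D).transpose) = p * frobSq D := by
  rw [frobSq_mul_transpose]
  have : ∀ i, ∑ k, frobSq (rowBlock (stack Z) i * (rowBlock (singleBlock j D) k).transpose) =
      frobSq D := by
    intro i
    rw [Finset.sum_eq_single j]
    · rw [rowBlock_singleBlock, if_pos rfl, rowBlock_stack, frobSq_permMatrix_mul,
        frobSq_transpose]
    · intro k _ hk
      simp [rowBlock_singleBlock, hk]
    · simp
  simp [this]

/-- The unnormalised loss `∑ⱼ ‖Z_j - Z*_j‖²`. -/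
noncomputable def errSq (Z Z' : Fin p → Equiv.Perm (Fin d)) : ℝ :=
  ∑ j, frobSq ((Z j).permMatrix ℝ - (Z' j).permMatrix ℝ)

lemma errSq_nonneg (Z Z' : Fin p → Equiv.Perm (Fin d)) : 0 ≤ errSq Z Z' :=
  Finset.sum_nonneg fun _ _ => frobSq_nonneg _

lemma loss_eq (lam : ℝ) (Z Z' : Fin p → Equiv.Perm (Fin d)) :
    loss lam Z Z' = p * lam ^ 2 * errSq Z Z' := rfl

lemma four_mul_card_ne_le_errSq (Z Z' : Fin p → Equiv.Perm (Fin d)) :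
    4 * ((Finset.univ.filter fun i => Z i ≠ Z' i).card : ℝ) ≤ errSq Z Z' := by
  calc 4 * ((Finset.univ.filter fun i => Z i ≠ Z' i).card : ℝ)
      = ∑ i ∈ Finset.univ.filter fun i => Z i ≠ Z' i, (4 : ℝ) := by simp [mul_comm]
    _ ≤ ∑ i ∈ Finset.univ.filter fun i => Z i ≠ Z' i,
        frobSq ((Z i).permMatrix ℝ - (Z' i).permMatrix ℝ) :=
      Finset.sum_le_sum fun i hi => four_le_frobSq_permMatrix_sub (Finset.mem_filter.1 hi).2
    _ ≤ errSq Z Z' := Finset.sum_le_sum_of_subset_of_nonneg (Finset.filter_subset _ _)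
        fun _ _ _ => frobSq_nonneg _

/-- For σ ≠ τ the left side is at most 4‖A‖², and 4 is the minimal squared distance. -/
lemma frobSq_permMatrix_sub_mul_le (σ τ : Equiv.Perm (Fin d)) (A : Matrix (Fin d) (Fin d) ℝ) :
    frobSq ((σ.permMatrix ℝ - τ.permMatrix ℝ) * A) ≤
      frobSq (σ.permMatrix ℝ - τ.permMatrix ℝ) * frobSq A := by
  by_cases h : σ = τ
  · simp [h]
  · rw [sub_mul]
    have h1 := frobSq_sub_le (σ.permMatrix ℝ * A) (τ.permMatrix ℝ * A)
    rw [frobSq_permMatrix_mul, frobSq_permMatrix_mul] at h1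
    nlinarith [frobSq_nonneg A, four_le_frobSq_permMatrix_sub h]

lemma frobSq_stack_sub_mul_transpose_le (Z Z' U U' : Fin p → Equiv.Perm (Fin d)) :
    frobSq ((stack Z - stack Z') * (stack U - stack U').transpose) ≤
      errSq Z Z' * errSq U U' := by
  rw [frobSq_mul_transpose, errSq, errSq, Finset.sum_mul_sum]
  refine Finset.sum_le_sum fun i _ => Finset.sum_le_sum fun k _ => ?_
  rw [rowBlock_sub, rowBlock_sub, rowBlock_stack, rowBlock_stack, rowBlock_stack, rowBlock_stack]
  exact (frobSq_permMatrix_sub_mul_le _ _ _).trans_eq (by rw [frobSq_transpose])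

/-- The signal part of the score of a candidate `σ` for the `j`-th block. -/
lemma matInner_signal_le (Z Z' : Fin p → Equiv.Perm (Fin d)) (j : Fin p)
    (σ : Equiv.Perm (Fin d)) :
    matInner (stack Z' * (stack Z').transpose)
        (stack Z * (singleBlock j (σ.permMatrix ℝ - (Z' j).permMatrix ℝ)).transpose) ≤
      -(frobSq (σ.permMatrix ℝ - (Z' j).permMatrix ℝ) * (p / 2 - errSq Z Z' / 4)) := by
  set D := σ.permMatrix ℝ - (Z' j).permMatrix ℝ with hD
  have hDt : D.transpose = σ⁻¹.permMatrix ℝ - (Z' j)⁻¹.permMatrix ℝ := by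
    rw [hD, Matrix.transpose_sub, Matrix.transpose_permMatrix, Matrix.transpose_permMatrix]
  -- A correct block of `Z` contributes exactly -‖D‖²/2. A wrong one may flip this to +‖D‖²/2, and
  -- at most `errSq Z Z' / 4` blocks are wrong.
  have key : ∀ i, matInner ((Z' i).permMatrix ℝ * ((Z' j).permMatrix ℝ).transpose)
      ((Z i).permMatrix ℝ * D.transpose) ≤
      -(frobSq D / 2) + if Z i ≠ Z' i then frobSq D else 0 := by
    intro i
    have e : (Z i).permMatrix ℝ * D.transpose =
        (σ⁻¹ * Z i).permMatrix ℝ - ((Z' j)⁻¹ * Z i).permMatrix ℝ := by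
      rw [hDt, mul_sub, Matrix.permMatrix_mul, Matrix.permMatrix_mul]
    have e2 : frobSq ((σ⁻¹ * Z i).permMatrix ℝ - ((Z' j)⁻¹ * Z i).permMatrix ℝ) = frobSq D := by
      rw [← e, frobSq_permMatrix_mul, frobSq_transpose]
    rw [e, permMatrix_mul_transpose]
    split_ifs with h
    · have := matInner_permMatrix_sub_le ((Z' j)⁻¹ * Z' i) (σ⁻¹ * Z i) ((Z' j)⁻¹ * Z i)
      rw [e2] at this
      linarith
    · have hZ : Z i = Z' i := not_not.1 h
      have := matInner_permMatrix_sub_self (σ⁻¹ * Z i) ((Z' j)⁻¹ * Z i)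
      rw [e2] at this
      rw [← hZ, this, add_zero]
  have hsum : matInner (stack Z' * (stack Z').transpose)
      (stack Z * (singleBlock j D).transpose) =
      ∑ i, matInner ((Z' i).permMatrix ℝ * ((Z' j).permMatrix ℝ).transpose)
        ((Z i).permMatrix ℝ * D.transpose) := by
    rw [matInner_mul_transpose]
    refine Finset.sum_congr rfl fun i _ => ?_
    rw [Finset.sum_eq_single j]
    · simp [rowBlock_singleBlock, rowBlock_stack]
    · intro k _ hk
      simp [rowBlock_singleBlock, hk, matInner]
    · simp
  rw [hsum]
  refine (Finset.sum_le_sum fun i _ => key i).trans ?_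
  rw [Finset.sum_add_distrib, Finset.sum_ite, Finset.sum_const, Finset.sum_const,
    Finset.sum_const_zero, Finset.card_univ, Fintype.card_fin, nsmul_eq_mul, nsmul_eq_mul]
  nlinarith [four_mul_card_ne_le_errSq Z Z', frobSq_nonneg D]

/-- Lower bound for the signal part of the estimated scale. -/
lemma le_matInner_stack (Z Z' : Fin p → Equiv.Perm (Fin d)) (h : errSq Z Z' ≤ p) :
    (p - errSq Z Z' / 4) ^ 2 * d ≤
      matInner (stack Z' * (stack Z').transpose) (stack Z * (stack Z).transpose) := by
  rw [matInner_mul_transpose]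
  simp only [rowBlock_stack, permMatrix_mul_transpose]
  -- Every block pair contributes nonnegatively, and pairs with both blocks correct contribute d;
  -- the number of correct blocks therefore enters squared.
  have key : ∀ i k, (if Z i = Z' i then (1 : ℝ) else 0) * (if Z k = Z' k then (1 : ℝ) else 0) * d ≤
      matInner (((Z' k)⁻¹ * Z' i).permMatrix ℝ) (((Z k)⁻¹ * Z i).permMatrix ℝ) := by
    intro i k
    have h0 : 0 ≤ matInner (((Z' k)⁻¹ * Z' i).permMatrix ℝ) (((Z k)⁻¹ * Z i).permMatrix ℝ) :=
      Finset.sum_nonneg fun a _ => Finset.sum_nonneg fun b _ => by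
        rw [permMatrix_entry, permMatrix_entry]
        split_ifs <;> norm_num
    by_cases hi : Z i = Z' i
    · by_cases hk : Z k = Z' k
      · rw [if_pos hi, if_pos hk, hi, hk, ← frobSq_permMatrix ((Z' k)⁻¹ * Z' i)]
        simp [matInner, frobSq, sq]
      · simpa [hk] using h0
    · simpa [hi] using h0
  refine le_trans ?_ (Finset.sum_le_sum fun i _ => Finset.sum_le_sum fun k _ => key i k)
  simp only [← Finset.sum_mul]
  rw [← Finset.sum_mul_sum, ← sq]
  have hc : (∑ i, if Z i = Z' i then (1 : ℝ) else 0) =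
      p - ((Finset.univ.filter fun i => Z i ≠ Z' i).card : ℝ) := by
    have h1 := Finset.card_filter_add_card_filter_not (s := (Finset.univ : Finset (Fin p)))
      (fun i => Z i = Z' i)
    rw [Finset.card_univ, Fintype.card_fin] at h1
    rw [Finset.sum_boole, eq_sub_iff_add_eq]
    exact_mod_cast h1
  rw [hc]
  have := four_mul_card_ne_le_errSq Z Z'
  have h0 := errSq_nonneg Z Z'
  refine mul_le_mul_of_nonneg_right (pow_le_pow_left₀ ?_ ?_ 2) (Nat.cast_nonneg d) <;> linarith

end Blocks

/-! ### Gaussian tails of linear functionals of the noise -/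

section Tail

variable {p d : ℕ}

lemma sum_sum_eq_sum_lt_add_diag (F : Fin p → Fin p → ℝ) :
    ∑ i, ∑ k, F i k =
      ∑ q : {q : Fin p × Fin p // q.1 < q.2}, (F q.1.1 q.1.2 + F q.1.2 q.1.1) + ∑ i, F i i := by
  have h1 : ∀ G : Fin p × Fin p → ℝ, ∑ q : {q : Fin p × Fin p // q.1 < q.2}, G q.1 =
      ∑ x : Fin p × Fin p, if x.1 < x.2 then G x else 0 := by
    intro G
    rw [← Finset.sum_filter]
    exact (Finset.sum_subtype _ (by simp) G).symm
  have h2 : ∑ x : Fin p × Fin p, (if x.1 < x.2 then F x.2 x.1 else 0) =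
      ∑ x : Fin p × Fin p, if x.2 < x.1 then F x.1 x.2 else 0 :=
    Equiv.sum_comp (Equiv.prodComm (Fin p) (Fin p))
      fun x : Fin p × Fin p => if x.2 < x.1 then F x.1 x.2 else 0
  have h3 : ∑ i, F i i = ∑ x : Fin p × Fin p, if x.1 = x.2 then F x.1 x.2 else 0 := by
    rw [Fintype.sum_prod_type]
    simp
  rw [Finset.sum_add_distrib, h1 fun x => F x.1 x.2, h1 fun x => F x.2 x.1, h2, h3,
    ← Finset.sum_add_distrib, ← Finset.sum_add_distrib, ← Fintype.sum_prod_type']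
  refine Finset.sum_congr rfl fun x _ => ?_
  rcases lt_trichotomy x.1 x.2 with h | h | h
  · simp [h, h.not_gt, h.ne]
  · simp [h]
  · simp [h, h.not_gt, h.ne']

/-- The indices of the free entries of the noise. -/
abbrev NoiseIdx (p d : ℕ) : Type := {q : Fin p × Fin p // q.1 < q.2} × Fin d × Fin d

/-- The coefficient of a free entry of the noise in `matInner W M`. -/
def noiseCoeff (M : Matrix (Fin p × Fin d) (Fin p × Fin d) ℝ) (q : NoiseIdx p d) : ℝ :=
  M (q.1.1.1, q.2.1) (q.1.1.2, q.2.2) + M (q.1.1.2, q.2.2) (q.1.1.1, q.2.1)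

lemma sum_noiseIdx (f : NoiseIdx p d → ℝ) :
    ∑ q, f q = ∑ q : {q : Fin p × Fin p // q.1 < q.2}, ∑ a, ∑ b, f (q, a, b) := by
  rw [Fintype.sum_prod_type]
  exact Finset.sum_congr rfl fun q _ => Fintype.sum_prod_type _

lemma sum_blocks (f : Fin p × Fin d → Fin p × Fin d → ℝ) :
    ∑ r, ∑ s, f r s = ∑ i, ∑ k, ∑ a, ∑ b, f (i, a) (k, b) := by
  simp only [Fintype.sum_prod_type]
  exact Finset.sum_congr rfl fun i _ => Finset.sum_comm

lemma matInner_eq_sum_noiseCoeff {W : Matrix (Fin p × Fin d) (Fin p × Fin d) ℝ}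
    (hs : ∀ i j a b, W (i, a) (j, b) = W (j, b) (i, a)) (h0 : ∀ i a b, W (i, a) (i, b) = 0)
    (M : Matrix (Fin p × Fin d) (Fin p × Fin d) ℝ) :
    matInner W M =
      ∑ q : NoiseIdx p d, noiseCoeff M q * W (q.1.1.1, q.2.1) (q.1.1.2, q.2.2) := by
  rw [matInner, sum_blocks fun r s => W r s * M r s, sum_sum_eq_sum_lt_add_diag, sum_noiseIdx]
  simp only [h0, zero_mul, Finset.sum_const_zero, add_zero]
  refine Finset.sum_congr rfl fun q _ => ?_
  rw [Finset.sum_comm (f := fun a b => W (q.1.2, a) (q.1.1, b) * M (q.1.2, a) (q.1.1, b)),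
    ← Finset.sum_add_distrib]
  refine Finset.sum_congr rfl fun a _ => ?_
  rw [← Finset.sum_add_distrib]
  refine Finset.sum_congr rfl fun b _ => ?_
  rw [hs q.1.2 q.1.1 b a, noiseCoeff]
  ring

lemma sum_noiseIdx_sq_le (M : Matrix (Fin p × Fin d) (Fin p × Fin d) ℝ) :
    ∑ q : NoiseIdx p d, (M (q.1.1.1, q.2.1) (q.1.1.2, q.2.2) ^ 2 +
      M (q.1.1.2, q.2.2) (q.1.1.1, q.2.1) ^ 2) ≤ frobSq M := by
  rw [frobSq, sum_blocks fun r s => M r s ^ 2, sum_sum_eq_sum_lt_add_diag, sum_noiseIdx]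
  refine le_add_of_le_of_nonneg (le_of_eq ?_)
    (Finset.sum_nonneg fun i _ => Finset.sum_nonneg fun a _ => Finset.sum_nonneg fun b _ =>
      sq_nonneg _)
  refine Finset.sum_congr rfl fun q _ => ?_
  rw [Finset.sum_comm (f := fun a b => M (q.1.2, a) (q.1.1, b) ^ 2), ← Finset.sum_add_distrib]
  exact Finset.sum_congr rfl fun a _ => Finset.sum_add_distrib

lemma sum_noiseCoeff_sq_le (M : Matrix (Fin p × Fin d) (Fin p × Fin d) ℝ) :
    ∑ q, noiseCoeff M q ^ 2 ≤ 2 * frobSq M := by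
  refine le_trans ?_ (mul_le_mul_of_nonneg_left (sum_noiseIdx_sq_le M) zero_le_two)
  rw [Finset.mul_sum]
  exact Finset.sum_le_sum fun q _ => add_sq_le

/-- With a single nonzero block column, at most one of the two terms of each coefficient survives.
The factor 2 of the general bound is thus avoided; keeping it would halve the exponent of the ideal
error. -/
lemma sum_noiseCoeff_sq_le_of_support {M : Matrix (Fin p × Fin d) (Fin p × Fin d) ℝ} (j : Fin p)
    (hM : ∀ i k a b, k ≠ j → M (i, a) (k, b) = 0) :
    ∑ q, noiseCoeff M q ^ 2 ≤ frobSq M := by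
  refine le_trans (Finset.sum_le_sum fun q _ => le_of_eq ?_) (sum_noiseIdx_sq_le M)
  rw [noiseCoeff]
  by_cases h : q.1.1.2 = j
  · rw [hM q.1.1.2 q.1.1.1 q.2.2 q.2.1 (h ▸ q.1.2.ne)]
    ring
  · rw [hM q.1.1.1 q.1.1.2 q.2.1 q.2.2 h]
    ring

variable {Ω : Type*} [MeasurableSpace Ω] {μ : Measure Ω}

lemma hasSubgaussianMGF_of_hasLaw_gaussianReal {X : Ω → ℝ} {v : NNReal}
    (h : HasLaw X (gaussianReal 0 v) μ) : HasSubgaussianMGF X v μ where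
  integrable_exp_mul t := by
    have := integrable_exp_mul_gaussianReal (μ := 0) (v := v) t
    rw [← h.map_eq] at this
    exact this.comp_aemeasurable h.aemeasurable
  mgf_le t := by
    rw [mgf_gaussianReal h.map_eq]
    simp

/-- Chernoff bound with `v` only an upper bound for the variance. Multiplying the event by λ treats
both signs of λ at once. -/
lemma IsGaussianNoise.measure_le_mul_matInner_le
    {W : Ω → Matrix (Fin p × Fin d) (Fin p × Fin d) ℝ} (hW : IsGaussianNoise W μ)
    {M : Matrix (Fin p × Fin d) (Fin p × Fin d) ℝ} {v : ℝ} (hv : 0 ≤ v)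
    (hM : ∑ q, noiseCoeff M q ^ 2 ≤ v) {t lam : ℝ} (ht : 0 ≤ t) :
    μ.real {ω | t * lam ^ 2 ≤ lam * matInner (W ω) M} ≤
      Real.exp (-(t ^ 2 * lam ^ 2 / (2 * v))) := by
  let X : NoiseIdx p d → Ω → ℝ := fun q ω =>
    (lam * noiseCoeff M q) * W ω (q.1.1.1, q.2.1) (q.1.1.2, q.2.2)
  have hX : iIndepFun X μ :=
    hW.indep.comp (fun q x => (lam * noiseCoeff M q) * x) fun q => by fun_prop
  have hsub : ∀ q ∈ (Finset.univ : Finset (NoiseIdx p d)), HasSubgaussianMGF (X q)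
      ((lam * noiseCoeff M q) ^ 2).toNNReal μ := fun q _ => by
    convert (hasSubgaussianMGF_of_hasLaw_gaussianReal
      (hW.law _ _ q.1.2 q.2.1 q.2.2)).const_mul (lam * noiseCoeff M q) using 1
    exact (Real.toNNReal_of_nonneg (sq_nonneg _)).trans (mul_one _).symm
  have hc : ((∑ q : NoiseIdx p d, ((lam * noiseCoeff M q) ^ 2).toNNReal : NNReal) : ℝ) ≤
      lam ^ 2 * v := by
    refine le_trans (le_of_eq ?_) (mul_le_mul_of_nonneg_left hM (sq_nonneg lam))
    rw [NNReal.coe_sum, Finset.mul_sum]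
    refine Finset.sum_congr rfl fun q _ => ?_
    rw [Real.coe_toNNReal _ (sq_nonneg _), mul_pow]
  have hsum := HasSubgaussianMGF.sum_of_iIndepFun hX hsub
  have hsum' : HasSubgaussianMGF (fun ω => ∑ q, X q ω)
      (lam ^ 2 * v).toNNReal μ :=
    ⟨hsum.integrable_exp_mul, fun s => (hsum.mgf_le s).trans (Real.exp_le_exp.2 (by
      rw [Real.coe_toNNReal _ (mul_nonneg (sq_nonneg lam) hv)]
      have := mul_le_mul_of_nonneg_right hc (sq_nonneg s)
      exact div_le_div_of_nonneg_right this zero_le_two))⟩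
  have h := hsum'.measure_ge_le (mul_nonneg ht (sq_nonneg lam))
  have hset : {ω | t * lam ^ 2 ≤ lam * matInner (W ω) M} =
      {ω | t * lam ^ 2 ≤ ∑ q, X q ω} := by
    ext ω
    rw [Set.mem_ofPred_eq, Set.mem_ofPred_eq,
      matInner_eq_sum_noiseCoeff (hW.symm ω) (hW.diag ω), Finset.mul_sum]
    simp only [X, mul_assoc]
  rw [hset]
  refine h.trans_eq (congrArg Real.exp ?_)
  rw [Real.coe_toNNReal _ (mul_nonneg (sq_nonneg lam) hv)]
  -- If λ or v vanishes, division by zero makes both exponents 0 and both bounds equal to 1.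
  rcases eq_or_ne lam 0 with rfl | hlam
  · simp
  rcases eq_or_ne v 0 with rfl | hv
  · simp
  field_simp

end Tail

/-! ### Deterministic analysis of one iteration -/

section Step

variable {p d : ℕ} {lam : ℝ} {W : Matrix (Fin p × Fin d) (Fin p × Fin d) ℝ}
  {Zstar Z Z' : Fin p → Equiv.Perm (Fin d)}

/-- The candidate `σ` for the `j`-th block beats the truth at the idealised update. -/
def IdealError (κ lam : ℝ) (Zstar : Fin p → Equiv.Perm (Fin d))
    (W : Matrix (Fin p × Fin d) (Fin p × Fin d) ℝ) (j : Fin p) (σ : Equiv.Perm (Fin d)) : Prop :=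
  (1 - κ) * p * frobSq (σ.permMatrix ℝ - (Zstar j).permMatrix ℝ) / 2 * lam ^ 2 ≤
    lam * matInner W
      (stack Zstar * (singleBlock j (σ.permMatrix ℝ - (Zstar j).permMatrix ℝ)).transpose)

/-- The noise created by the errors of `Z` is large in the direction of `U - Z*`. -/
def CrossError (κ lam : ℝ) (Zstar : Fin p → Equiv.Perm (Fin d))
    (W : Matrix (Fin p × Fin d) (Fin p × Fin d) ℝ) (Z U : Fin p → Equiv.Perm (Fin d)) : Prop :=
  errSq Z Zstar < 2 * errSq U Zstar ∧
    κ * p * errSq U Zstar / 4 * lam ^ 2 ≤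
      lam * matInner W ((stack Z - stack Zstar) * (stack U - stack Zstar).transpose)

/-- The noise may change the sign of the estimated scale at `Z`. -/
def ScaleError (lam : ℝ) (W : Matrix (Fin p × Fin d) (Fin p × Fin d) ℝ)
    (Z : Fin p → Equiv.Perm (Fin d)) : Prop :=
  (p : ℝ) ^ 2 * d / 2 * lam ^ 2 ≤
    lam * matInner W (-(stack Z * (stack Z).transpose))

open Classical in
/-- The total loss caused by the errors of the idealised update. -/
noncomputable def idealLoss (κ lam : ℝ) (Zstar : Fin p → Equiv.Perm (Fin d))
    (W : Matrix (Fin p × Fin d) (Fin p × Fin d) ℝ) : ℝ :=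
  ∑ x : Fin p × Equiv.Perm (Fin d),
    if x.2 ≠ Zstar x.1 ∧ IdealError κ lam Zstar W x.1 x.2 then
      frobSq (x.2.permMatrix ℝ - (Zstar x.1).permMatrix ℝ) else 0

/-- The least squares property pins down the estimated scale. -/
lemma scale_eq {Y : Matrix (Fin p × Fin d) (Fin p × Fin d) ℝ} (hp : 0 < p) (hd : 0 < d) {c : ℝ}
    (hc : ∀ B' ∈ paramSpace Z, frobSq (Y - stack Z * (c • stack Z).transpose) ≤
      frobSq (Y - stack Z * B'.transpose)) :
    c * (p ^ 2 * d) = matInner Y (stack Z * (stack Z).transpose) := by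
  have hN : (0 : ℝ) < p ^ 2 * d := by positivity
  set S := matInner Y (stack Z * (stack Z).transpose) with hS
  -- Comparison with the projection coefficient: the excess of the objective at c is (c - S/(p²d))²
  -- p²d.
  have h := hc ((S / (p ^ 2 * d)) • stack Z) ⟨_, rfl⟩
  rw [Matrix.transpose_smul, Matrix.transpose_smul, Matrix.mul_smul, Matrix.mul_smul,
    frobSq_sub_smul, frobSq_sub_smul, frobSq_stack_mul_transpose, ← hS] at h
  have e : S = S / (p ^ 2 * d) * (p ^ 2 * d) := by field_simp
  have h2 : (c - S / (p ^ 2 * d)) ^ 2 * (p ^ 2 * d) ≤ 0 := by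
    generalize S / (p ^ 2 * d : ℝ) = x at *
    rw [e] at h
    linarith
  have h3 : (c - S / (p ^ 2 * d)) ^ 2 = 0 :=
    le_antisymm (nonpos_of_mul_nonpos_left h2 hN) (sq_nonneg _)
  rw [e, sub_eq_zero.1 (pow_eq_zero_iff two_ne_zero |>.1 h3)]

/-- Optimality of the update of the `j`-th block. -/
lemma mul_matInner_nonneg_of_isMin {Y : Matrix (Fin p × Fin d) (Fin p × Fin d) ℝ} {c : ℝ}
    {j : Fin p} {σ : Equiv.Perm (Fin d)}
    (h : ∀ U : Equiv.Perm (Fin d),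
      frobSq (blockCol Y j - (c • stack Z) * (σ.permMatrix ℝ).transpose) ≤
        frobSq (blockCol Y j - (c • stack Z) * (U.permMatrix ℝ).transpose))
    (τ : Equiv.Perm (Fin d)) :
    0 ≤ c * matInner Y
      (stack Z * (singleBlock j (σ.permMatrix ℝ - τ.permMatrix ℝ)).transpose) := by
  have h1 := h τ
  -- The norm of Z σᵀ does not depend on σ, so the quadratic terms cancel.
  rw [Matrix.smul_mul, Matrix.smul_mul, frobSq_sub_smul, frobSq_sub_smul,
    frobSq_stack_mul_permMatrix_transpose, frobSq_stack_mul_permMatrix_transpose] at h1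
  rw [matInner_mul_singleBlock_transpose, Matrix.transpose_sub, Matrix.mul_sub,
    matInner_sub_right]
  linarith

lemma stack_sub_eq_sum_singleBlock (U V : Fin p → Equiv.Perm (Fin d)) :
    stack U - stack V =
      ∑ j, singleBlock j ((U j).permMatrix ℝ - (V j).permMatrix ℝ) := by
  ext ⟨i, a⟩ b
  simp [Matrix.sum_apply, singleBlock, stack]

/-- The positivity of `lam * c` for the estimated scale `c`. -/
lemma mul_scale_pos (hp : 0 < p) (hd : 0 < d) (hlam : lam ≠ 0)
    (hZ : errSq Z Zstar ≤ p / 2) (hS : ¬ ScaleError lam W Z) {c : ℝ}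
    (hc : c * (p ^ 2 * d) =
      matInner (observation lam Zstar W) (stack Z * (stack Z).transpose)) :
    0 < lam * c := by
  have hN : (0 : ℝ) < p ^ 2 * d := by positivity
  have hp' : (0 : ℝ) < p := by positivity
  have hd' : (0 : ℝ) < d := by positivity
  have hl : 0 < lam ^ 2 := by positivity
  have h1 := le_matInner_stack Z Zstar (by linarith)
  rw [observation, matInner_add_left, matInner_smul_left] at hc
  rw [ScaleError, ← neg_one_smul ℝ, matInner_smul_right, not_le] at hS
  set s := matInner (stack Zstar * (stack Zstar).transpose) (stack Z * (stack Z).transpose)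
  have h2 : (p : ℝ) ^ 2 * d / 2 ≤ s := by
    refine le_trans ?_ h1
    -- The factor 3/4 suffices because its square 9/16 exceeds 1/2.
    have : (3 / 4 * p : ℝ) ≤ p - errSq Z Zstar / 4 := by linarith
    nlinarith [pow_le_pow_left₀ (by positivity) this 2]
  have h3 : 0 < lam * c * (p ^ 2 * d) := by
    rw [mul_assoc, hc]
    nlinarith
  exact pos_of_mul_pos_left h3 hN.le

open Classical in
/-- One step of the algorithm contracts the error, up to the errors of the idealised update. -/
lemma errSq_step_le (hp : 0 < p) (hd : 0 < d) (hlam : lam ≠ 0) {κ : ℝ} (hκ : κ ≤ 1 / 2)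
    (hZ : errSq Z Zstar ≤ κ * p)
    (hS : ¬ ScaleError lam W Z) (hC : ∀ U, ¬ CrossError κ lam Zstar W Z U)
    (h : IsStep (observation lam Zstar W) Z Z') :
    errSq Z' Zstar ≤ idealLoss κ lam Zstar W + errSq Z Zstar / 2 := by
  obtain ⟨B, ⟨c, rfl⟩, hmin, hupd⟩ := h
  have hp' : (0 : ℝ) < p := by positivity
  have hpos : 0 < lam * c := mul_scale_pos hp hd hlam (by nlinarith) hS (scale_eq hp hd hmin)
  set m : Fin p → ℝ := fun j => frobSq ((Z' j).permMatrix ℝ - (Zstar j).permMatrix ℝ) with hm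
  let bad : Fin p → Prop := fun j => Z' j ≠ Zstar j ∧ IdealError κ lam Zstar W j (Z' j)
  -- Blocks already paid for by `idealLoss` are reset to the truth. What remains is a configuration
  -- to which the uniform cross bound applies.
  let U : Fin p → Equiv.Perm (Fin d) := fun j => if bad j then Zstar j else Z' j
  have hsplit : errSq Z' Zstar = (∑ j, if bad j then m j else 0) + errSq U Zstar := by
    rw [errSq, errSq, ← Finset.sum_add_distrib]
    refine Finset.sum_congr rfl fun j _ => ?_
    by_cases hb : bad j <;> simp [U, hb, hm]
  have hideal : (∑ j, if bad j then m j else 0) ≤ idealLoss κ lam Zstar W := by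
    rw [idealLoss, Fintype.sum_prod_type]
    refine Finset.sum_le_sum fun j _ => ?_
    refine Finset.single_le_sum (f := fun σ : Equiv.Perm (Fin d) =>
      if σ ≠ Zstar j ∧ IdealError κ lam Zstar W j σ then
        frobSq (σ.permMatrix ℝ - (Zstar j).permMatrix ℝ) else 0) (fun σ _ => ?_)
      (Finset.mem_univ (Z' j))
    show (0 : ℝ) ≤ if _ then _ else _
    split_ifs
    exacts [frobSq_nonneg _, le_rfl]
  have hU : errSq U Zstar ≤ errSq Z Zstar / 2 := by
    by_contra! hcon
    refine hC U ⟨by linarith, ?_⟩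
    rw [stack_sub_eq_sum_singleBlock U, Matrix.transpose_sum, Matrix.mul_sum,
      matInner_sum_right, errSq, Finset.mul_sum, Finset.sum_div, Finset.sum_mul, Finset.mul_sum]
    refine Finset.sum_le_sum fun j _ => ?_
    by_cases hj : U j = Zstar j
    · have : singleBlock j (0 : Matrix (Fin d) (Fin d) ℝ) = 0 := by
        ext; simp [singleBlock]
      simp [hj, this, matInner]
    have hbj : ¬ bad j := fun hb => hj (by simp [U, hb])
    have hUj : U j = Z' j := by simp [U, hbj]
    rw [hUj] at hj ⊢
    have hI : ¬ IdealError κ lam Zstar W j (Z' j) := fun hI => hbj ⟨hj, hI⟩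
    have hopt := mul_matInner_nonneg_of_isMin (hupd j) (Zstar j)
    have hsig := matInner_signal_le Z Zstar j (Z' j)
    set D := (Z' j).permMatrix ℝ - (Zstar j).permMatrix ℝ with hD
    have hopt2 : 0 ≤ lam * matInner (observation lam Zstar W)
        (stack Z * (singleBlock j D).transpose) := by
      have : 0 ≤ (lam * c) * (lam * matInner (observation lam Zstar W)
          (stack Z * (singleBlock j D).transpose)) := by
        calc (0 : ℝ) ≤ lam ^ 2 * _ := mul_nonneg (sq_nonneg lam) hopt
          _ = _ := by ring
      exact nonneg_of_mul_nonneg_right this hpos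
    rw [observation, matInner_add_left, matInner_smul_left] at hopt2
    rw [IdealError, ← hD, not_le] at hI
    rw [Matrix.sub_mul, matInner_sub_right]
    have hD0 : 0 ≤ frobSq D := frobSq_nonneg D
    have hl : 0 ≤ lam ^ 2 := sq_nonneg lam
    -- The margin is p/2 - κp/4 - (1 - κ)p/2 = κp/4 per unit of ‖D‖², which is the threshold in
    -- `CrossError`.
    have h1 := mul_le_mul_of_nonneg_left hsig hl
    have h2 : frobSq D * errSq Z Zstar ≤ frobSq D * (κ * p) := mul_le_mul_of_nonneg_left hZ hD0
    have h3 := mul_le_mul_of_nonneg_left h2 hl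
    linarith
  linarith

end Step

/-! ### Probabilities of the exceptional events -/

section Probability

variable {Ω : Type*} [MeasurableSpace Ω] {μ : Measure Ω}

open Classical in
/-- Markov's inequality for weighted counts of arbitrary events. -/
lemma measureReal_lt_sum_ite_le [IsProbabilityMeasure μ] {ι : Type*} [Fintype ι]
    (P : ι → Ω → Prop) {w : ι → ℝ} (hw : ∀ i, 0 ≤ w i) {a : ℝ} (ha : 0 < a) :
    μ.real {ω | a < ∑ i, if P i ω then w i else 0} ≤
      (∑ i, w i * μ.real {ω | P i ω}) / a := by
  -- The events need not be measurable; their measurable hulls have the same measure.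
  let A : ι → Set Ω := fun i => toMeasurable μ {ω | P i ω}
  have hA : ∀ i, MeasurableSet (A i) := fun i => measurableSet_toMeasurable _ _
  have hint : ∀ i, Integrable ((A i).indicator fun _ => w i) μ := fun i =>
    (integrable_const _).indicator (hA i)
  have h0 : ∀ i ω, 0 ≤ (A i).indicator (fun _ => w i) ω := fun i ω =>
    Set.indicator_nonneg (fun _ _ => hw i) ω
  have hmarkov := mul_meas_ge_le_integral_of_nonneg (μ := μ)
    (f := fun ω => ∑ i, (A i).indicator (fun _ => w i) ω)
    (Eventually.of_forall fun ω => Finset.sum_nonneg fun i _ => h0 i ω)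
    (integrable_finsetSum _ fun i _ => hint i) a
  rw [integral_finsetSum _ fun i _ => hint i] at hmarkov
  rw [le_div_iff₀' ha]
  refine le_trans (mul_le_mul_of_nonneg_left (measureReal_mono fun ω hω => ?_) ha.le)
    (hmarkov.trans_eq (Finset.sum_congr rfl fun i _ => ?_))
  · rw [Set.mem_ofPred_eq] at hω ⊢
    refine hω.le.trans (Finset.sum_le_sum fun i _ => ?_)
    split_ifs with h
    · have : ω ∈ A i := subset_toMeasurable μ _ h
      simp [this]
    · exact h0 i ω
  · rw [integral_indicator_const _ (hA i), smul_eq_mul, mul_comm, measureReal_def,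
      measure_toMeasurable, measureReal_def]

lemma measureReal_exists_le_card_mul [IsFiniteMeasure μ] {ι : Type*} [Fintype ι]
    (P : ι → Ω → Prop) {b : ℝ} (h : ∀ i, μ.real {ω | P i ω} ≤ b) :
    μ.real {ω | ∃ i, P i ω} ≤ Fintype.card ι * b := by
  have : {ω | ∃ i, P i ω} = ⋃ i, {ω | P i ω} := by ext; simp
  rw [this]
  refine (measureReal_iUnion_fintype_le _).trans ((Finset.sum_le_sum fun i _ => h i).trans ?_)
  simp

lemma card_perm_le_exp (d : ℕ) :
    (Fintype.card (Equiv.Perm (Fin d)) : ℝ) ≤ Real.exp (d * Real.log d) := by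
  rcases Nat.eq_zero_or_pos d with rfl | hd
  · simp
  rw [Fintype.card_perm, Fintype.card_fin, mul_comm, ← Real.rpow_def_of_pos (by positivity),
    Real.rpow_natCast]
  exact_mod_cast Nat.factorial_le_pow d

lemma card_perm_pi_le_exp (p d : ℕ) :
    (Fintype.card (Fin p → Equiv.Perm (Fin d)) : ℝ) ≤ Real.exp (p * (d * Real.log d)) := by
  rw [Fintype.card_fun, Fintype.card_fin, Nat.cast_pow, Real.exp_nat_mul]
  exact pow_le_pow_left₀ (Nat.cast_nonneg _) (card_perm_le_exp d) p

variable {p d : ℕ} {lam κ : ℝ} {Zstar : Fin p → Equiv.Perm (Fin d)}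
  {W : Ω → Matrix (Fin p × Fin d) (Fin p × Fin d) ℝ}

lemma IsGaussianNoise.measure_idealError_le (hW : IsGaussianNoise W μ) (hp : 0 < p) (hκ : κ ≤ 1)
    {j : Fin p} {σ : Equiv.Perm (Fin d)} (hσ : σ ≠ Zstar j) :
    μ.real {ω | IdealError κ lam Zstar (W ω) j σ} ≤
      Real.exp (-((1 - κ) ^ 2 * (p * lam ^ 2) / 2)) := by
  have hm := four_le_frobSq_permMatrix_sub hσ
  have hM : ∑ q, noiseCoeff (stack Zstar *
      (singleBlock j (σ.permMatrix ℝ - (Zstar j).permMatrix ℝ)).transpose) q ^ 2 ≤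
      p * frobSq (σ.permMatrix ℝ - (Zstar j).permMatrix ℝ) := by
    rw [← frobSq_stack_mul_singleBlock_transpose Zstar j]
    refine sum_noiseCoeff_sq_le_of_support j fun i k a b hk => ?_
    simp [Matrix.mul_apply, singleBlock, hk]
  simp only [IdealError]
  set m := frobSq (σ.permMatrix ℝ - (Zstar j).permMatrix ℝ)
  have hp' : (0 : ℝ) < p := by positivity
  have h1 : 0 ≤ 1 - κ := by linarith
  refine (hW.measure_le_mul_matInner_le (by positivity) hM
    (t := (1 - κ) * p * m / 2) (by positivity)).trans (Real.exp_le_exp.2 (neg_le_neg ?_))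
  have : ((1 - κ) * p * m / 2) ^ 2 * lam ^ 2 / (2 * (p * m)) =
      (1 - κ) ^ 2 * (p * lam ^ 2) / 8 * m := by
    field_simp
    ring
  rw [this]
  have h2 : 0 ≤ (1 - κ) ^ 2 * (p * lam ^ 2) / 8 := by positivity
  nlinarith

/-- The condition `errSq Z < 2 errSq U` bounds the variance by 4 `errSq U`², so the unknown error
size cancels and the exponent is uniform, of order p · pλ². -/
lemma IsGaussianNoise.measure_crossError_le (hW : IsGaussianNoise W μ) (hκ : 0 ≤ κ)
    (Z U : Fin p → Equiv.Perm (Fin d)) :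
    μ.real {ω | CrossError κ lam Zstar (W ω) Z U} ≤
      Real.exp (-(κ ^ 2 * p * (p * lam ^ 2) / 128)) := by
  by_cases h : errSq Z Zstar < 2 * errSq U Zstar
  · have hU : 0 < errSq U Zstar := by linarith [errSq_nonneg Z Zstar]
    have hM : ∑ q, noiseCoeff ((stack Z - stack Zstar) * (stack U - stack Zstar).transpose) q ^ 2 ≤
        4 * errSq U Zstar ^ 2 := by
      refine (sum_noiseCoeff_sq_le _).trans ?_
      have := frobSq_stack_sub_mul_transpose_le Z Zstar U Zstar
      nlinarith
    simp only [CrossError, h, true_and]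
    refine (hW.measure_le_mul_matInner_le (by positivity) hM
      (t := κ * p * errSq U Zstar / 4) (by positivity)).trans_eq ?_
    congr 2
    field_simp
    ring
  · simp only [CrossError, h, false_and]
    simpa using (Real.exp_pos _).le

lemma IsGaussianNoise.measure_scaleError_le (hW : IsGaussianNoise W μ) (hp : 0 < p) (hd : 0 < d)
    (Z : Fin p → Equiv.Perm (Fin d)) :
    μ.real {ω | ScaleError lam (W ω) Z} ≤ Real.exp (-(p * d * (p * lam ^ 2) / 16)) := by
  have hM : ∑ q, noiseCoeff (-(stack Z * (stack Z).transpose)) q ^ 2 ≤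
      2 * ((p : ℝ) ^ 2 * d) := by
    refine (sum_noiseCoeff_sq_le _).trans_eq ?_
    rw [← neg_one_smul ℝ, frobSq_smul, frobSq_stack_mul_transpose]
    ring
  refine (hW.measure_le_mul_matInner_le (by positivity) hM
    (t := (p : ℝ) ^ 2 * d / 2) (by positivity)).trans_eq ?_
  have hp' : (0 : ℝ) < p := by positivity
  have hd' : (0 : ℝ) < d := by positivity
  congr 2
  field_simp
  ring

lemma one_lt_mul_log {d : ℕ} (hd : 2 ≤ d) : 1 < d * Real.log d := by
  have h2 : (2 : ℝ) ≤ d := by exact_mod_cast hd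
  have := Real.log_le_log two_pos h2
  nlinarith [Real.log_two_gt_d9]

/-- Turns what the union bounds leave after paying entropy into half of e^{-pd}; the cross and scale
events each take one half. -/
lemma exp_neg_four_mul_le {p d : ℕ} (hp : 0 < p) (hd : 2 ≤ d) :
    Real.exp (-(4 * (p * (d * Real.log d)))) ≤ Real.exp (-(p * d)) / 2 := by
  have h1 : (1 : ℝ) ≤ p := by exact_mod_cast hp
  have h2 : (2 : ℝ) ≤ d := by exact_mod_cast hd
  have h3 : Real.log 2 ≤ Real.log d := Real.log_le_log two_pos h2
  have h4 : (2 : ℝ) ≤ p * d := by nlinarith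
  have h6 : Real.exp (-(p * d)) / 2 = Real.exp (-(p * d) - Real.log 2) := by
    rw [Real.exp_sub, Real.exp_log two_pos]
  rw [h6, Real.exp_le_exp]
  have h5 : (p * d : ℝ) * 0.69 ≤ p * d * Real.log d :=
    mul_le_mul_of_nonneg_left (by linarith [Real.log_two_gt_d9]) (by linarith)
  nlinarith [Real.log_two_lt_d9]

/-- As 768 = 6 · 128, the tail exponent is at least 6 p d log d; the entropy of the pairs costs 2 of
the 6. -/
lemma IsGaussianNoise.measure_exists_crossError_le [IsProbabilityMeasure μ]
    (hW : IsGaussianNoise W μ) (hp : 0 < p)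
    (hd : 2 ≤ d) (hκ : 0 ≤ κ) (hq : 768 * (d * Real.log d) ≤ κ ^ 2 * (p * lam ^ 2)) :
    μ.real {ω | ∃ x : (Fin p → Equiv.Perm (Fin d)) × (Fin p → Equiv.Perm (Fin d)),
      CrossError κ lam Zstar (W ω) x.1 x.2} ≤ Real.exp (-(p * d)) / 2 := by
  refine (measureReal_exists_le_card_mul
    (fun (x : (Fin p → Equiv.Perm (Fin d)) × (Fin p → Equiv.Perm (Fin d))) ω =>
      CrossError κ lam Zstar (W ω) x.1 x.2)
    fun x => hW.measure_crossError_le hκ x.1 x.2).trans ?_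
  refine le_trans ?_ (exp_neg_four_mul_le hp hd)
  rw [Fintype.card_prod, Nat.cast_mul]
  have hc := card_perm_pi_le_exp p d
  refine (mul_le_mul_of_nonneg_right (mul_le_mul hc hc (Nat.cast_nonneg _) (Real.exp_pos _).le)
    (Real.exp_pos _).le).trans ?_
  rw [← Real.exp_add, ← Real.exp_add, Real.exp_le_exp]
  have := mul_le_mul_of_nonneg_left hq (Nat.cast_nonneg (α := ℝ) p)
  linarith

lemma IsGaussianNoise.measure_exists_scaleError_le [IsProbabilityMeasure μ]
    (hW : IsGaussianNoise W μ) (hp : 0 < p)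
    (hd : 2 ≤ d) (hq : 768 * (d * Real.log d) ≤ p * lam ^ 2) :
    μ.real {ω | ∃ Z, ScaleError lam (W ω) Z} ≤ Real.exp (-(p * d)) / 2 := by
  have hd0 : 0 < d := by omega
  refine (measureReal_exists_le_card_mul (fun Z ω => ScaleError lam (W ω) Z)
    fun Z => hW.measure_scaleError_le hp hd0 Z).trans ?_
  refine le_trans ?_ (exp_neg_four_mul_le hp hd)
  refine (mul_le_mul_of_nonneg_right (card_perm_pi_le_exp p d) (Real.exp_pos _).le).trans ?_
  rw [← Real.exp_add, Real.exp_le_exp]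
  have h1 : (1 : ℝ) ≤ d := by exact_mod_cast hd0
  have hL := one_lt_mul_log hd
  have h2 := mul_le_mul_of_nonneg_left hq (Nat.cast_nonneg (α := ℝ) p)
  have h3 : (p * (p * lam ^ 2) : ℝ) * 1 ≤ p * (p * lam ^ 2) * d :=
    mul_le_mul_of_nonneg_left h1 (by positivity)
  have h4 : (0 : ℝ) ≤ p * (d * Real.log d) := by positivity
  linarith

lemma IsGaussianNoise.measure_lt_idealLoss_le [IsProbabilityMeasure μ] (hW : IsGaussianNoise W μ)
    (hp : 0 < p) (hκ : κ ≤ 1) {a : ℝ} (ha : 0 < a) :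
    μ.real {ω | a < idealLoss κ lam Zstar (W ω)} ≤
      p * Real.exp (d * Real.log d) * (2 * d) *
        Real.exp (-((1 - κ) ^ 2 * (p * lam ^ 2) / 2)) / a := by
  classical
  have h := measureReal_lt_sum_ite_le (μ := μ)
    (fun (x : Fin p × Equiv.Perm (Fin d)) ω =>
      x.2 ≠ Zstar x.1 ∧ IdealError κ lam Zstar (W ω) x.1 x.2)
    (w := fun x => frobSq (x.2.permMatrix ℝ - (Zstar x.1).permMatrix ℝ))
    (fun _ => frobSq_nonneg _) ha
  refine le_trans (le_of_eq ?_) (h.trans (div_le_div_of_nonneg_right ?_ ha.le))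
  · simp only [idealLoss]
    congr!
  · set E := Real.exp (-((1 - κ) ^ 2 * (p * lam ^ 2) / 2))
    have hE : 0 < E := Real.exp_pos _
    calc _ ≤ ∑ _x : Fin p × Equiv.Perm (Fin d), 2 * d * E := by
          refine Finset.sum_le_sum fun x _ => ?_
          refine mul_le_mul (frobSq_permMatrix_sub_le _ _) ?_ measureReal_nonneg (by positivity)
          by_cases hx : x.2 = Zstar x.1
          · simp [hx, hE.le]
          · simp only [ne_eq, hx, not_false_eq_true, true_and]
            exact hW.measure_idealError_le hp hκ hx
      _ = p * Fintype.card (Equiv.Perm (Fin d)) * (2 * d * E) := by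
          rw [Finset.sum_const, Finset.card_univ, Fintype.card_prod, Fintype.card_fin,
            nsmul_eq_mul, Nat.cast_mul]
      _ ≤ p * Real.exp (d * Real.log d) * (2 * d * E) := by
          have := card_perm_le_exp d
          gcongr
      _ = _ := by ring

/-- The convergence of the iterations at a fixed problem size. -/
theorem IsGaussianNoise.one_sub_le_measure_contraction [IsProbabilityMeasure μ]
    (hW : IsGaussianNoise W μ) (hp : 0 < p) (hd : 2 ≤ d) (hlam : lam ≠ 0)
    (hκ0 : 0 ≤ κ) (hκ : κ ≤ 1 / 2)
    (hq : 768 * (d * Real.log d) ≤ κ ^ 2 * (p * lam ^ 2)) (hκq : 2 / (p * lam ^ 2) ≤ κ)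
    {a : ℝ} (ha0 : 0 ≤ a)
    (ha : a ≤ (1 - κ) ^ 2 * (p * lam ^ 2) / 2 - Real.sqrt (p * lam ^ 2) -
      Real.log (p * lam ^ 2) - Real.log (2 * d) - d * Real.log d)
    {ε η : ℝ} (hε : ε ≤ κ) {Z : ℕ → Ω → Fin p → Equiv.Perm (Fin d)}
    (hstep : ∀ t ω, IsStep (observation lam Zstar (W ω)) (Z t ω) (Z (t + 1) ω))
    (hη : 1 - η ≤ μ.real {ω | loss lam (Z 0 ω) Zstar ≤ ε * ((p : ℝ) ^ 2 * lam ^ 2)}) :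
    1 - η - Real.exp (-Real.sqrt (p * lam ^ 2)) - Real.exp (-(p * d)) ≤
      μ.real {ω | ∀ t : ℕ, 1 ≤ t → loss lam (Z t ω) Zstar ≤
        p * Real.exp (-a) + 1 / 2 * loss lam (Z (t - 1) ω) Zstar} := by
  have hp' : (0 : ℝ) < p := by positivity
  have hd' : (0 : ℝ) < d := by positivity
  have hQ : 0 < p * lam ^ 2 := by positivity
  have hL := one_lt_mul_log hd
  set q := p * lam ^ 2 with hqdef
  -- The loss is q times `errSq`, so this is the target p e^{-a} on the scale of `errSq`.
  set T := p * Real.exp (-a) / q with hT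
  have hTpos : 0 < T := by positivity
  -- Makes the ball `errSq ≤ κ p` invariant, since T + κp/2 ≤ κp.
  have hTκ : T ≤ κ * p / 2 := by
    have h1 : Real.exp (-a) ≤ 1 := Real.exp_le_one_iff.2 (by linarith)
    have h2 : T ≤ p * 1 / q := by rw [hT]; gcongr
    have h3 : (p * 1 / q : ℝ) = p / 2 * (2 / q) := by field_simp
    rw [h3] at h2
    nlinarith [mul_le_mul_of_nonneg_left hκq (by positivity : (0 : ℝ) ≤ p / 2)]
  have hC := hW.measure_exists_crossError_le (Zstar := Zstar) hp hd hκ0 hq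
  have hS := hW.measure_exists_scaleError_le (lam := lam) hp hd
    (hq.trans (mul_le_of_le_one_left hQ.le (pow_le_one₀ hκ0 (by linarith))))
  -- The bound `ha` on a is the exponent balance needed here: the log q pays for dividing by q in T,
  -- the other terms for the candidates, their cost 2d, and the probability e^{-√q}.
  have hI : μ.real {ω | T < idealLoss κ lam Zstar (W ω)} ≤ Real.exp (-Real.sqrt q) := by
    refine (hW.measure_lt_idealLoss_le hp (by linarith) hTpos).trans ?_
    rw [div_le_iff₀ hTpos, hT]
    have e1 : (2 * d : ℝ) = Real.exp (Real.log (2 * d)) := (Real.exp_log (by positivity)).symm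
    have e2 : Real.exp (-Real.log q) = 1 / q := by rw [Real.exp_neg, Real.exp_log hQ, one_div]
    have e3 : Real.exp (-Real.sqrt q) * (p * Real.exp (-a) / q) =
        p * Real.exp (-Real.sqrt q - a - Real.log q) := by
      rw [sub_eq_add_neg, sub_eq_add_neg, Real.exp_add, Real.exp_add, e2]
      ring
    rw [e3, mul_assoc, mul_assoc, e1, ← Real.exp_add, ← Real.exp_add]
    refine mul_le_mul_of_nonneg_left (Real.exp_le_exp.2 ?_) hp'.le
    linarith
  set G := {ω | ∀ t : ℕ, 1 ≤ t → loss lam (Z t ω) Zstar ≤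
        p * Real.exp (-a) + 1 / 2 * loss lam (Z (t - 1) ω) Zstar} with hG
  -- Covering the good initializations avoids complements, so only monotonicity and subadditivity of
  -- the outer measure are needed, with no measurability of `Z`.
  have hsub : {ω | loss lam (Z 0 ω) Zstar ≤ ε * ((p : ℝ) ^ 2 * lam ^ 2)} ⊆
      G ∪ ({ω | T < idealLoss κ lam Zstar (W ω)} ∪
        ({ω | ∃ x : (Fin p → Equiv.Perm (Fin d)) × (Fin p → Equiv.Perm (Fin d)),
          CrossError κ lam Zstar (W ω) x.1 x.2} ∪ {ω | ∃ Z, ScaleError lam (W ω) Z})) := by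
    intro ω hω
    by_contra hcon
    simp only [Set.mem_union, Set.mem_ofPred_eq, not_or, not_lt, not_exists, Prod.forall] at hcon
    obtain ⟨hnG, hnI, hnC, hnS⟩ := hcon
    have hone : ∀ t, errSq (Z t ω) Zstar ≤ κ * p →
        errSq (Z (t + 1) ω) Zstar ≤ T + errSq (Z t ω) Zstar / 2 := fun t ht =>
      (errSq_step_le hp (by omega) hlam hκ ht (hnS _) (fun U => hnC _ U) (hstep t ω)).trans
        (by linarith)
    have hinv : ∀ t, errSq (Z t ω) Zstar ≤ κ * p := by
      intro t
      induction t with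
      | zero =>
        have h1 : q * errSq (Z 0 ω) Zstar ≤ q * (ε * p) :=
          (show loss lam (Z 0 ω) Zstar ≤ _ from hω).trans_eq (by rw [hqdef]; ring)
        exact (le_of_mul_le_mul_left h1 hQ).trans (mul_le_mul_of_nonneg_right hε hp'.le)
      | succ t ih => linarith [hone t ih]
    refine hnG fun t ht => ?_
    obtain ⟨t, rfl⟩ := Nat.exists_eq_add_of_le' ht
    rw [Nat.add_sub_cancel, loss_eq, loss_eq, ← hqdef]
    have h2 := mul_le_mul_of_nonneg_left (hone t (hinv t)) hQ.le
    have h3 : q * T = p * Real.exp (-a) := by rw [hT]; field_simp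
    linarith
  have hfin := (measureReal_mono hsub (measure_ne_top μ _)).trans (measureReal_union_le _ _)
  have hfin2 := measureReal_union_le (μ := μ) {ω | T < idealLoss κ lam Zstar (W ω)}
    ({ω | ∃ x : (Fin p → Equiv.Perm (Fin d)) × (Fin p → Equiv.Perm (Fin d)),
          CrossError κ lam Zstar (W ω) x.1 x.2} ∪ {ω | ∃ Z, ScaleError lam (W ω) Z})
  have hfin3 := measureReal_union_le (μ := μ)
    {ω | ∃ x : (Fin p → Equiv.Perm (Fin d)) × (Fin p → Equiv.Perm (Fin d)),
          CrossError κ lam Zstar (W ω) x.1 x.2} {ω | ∃ Z, ScaleError lam (W ω) Z}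
  linarith

end Probability

end PermSync

/-! ### Asymptotics: choice of κ and δ -/

theorem theorem13 (p d : ℕ → ℕ) (lam ε : ℕ → ℝ)
    (hsnr : Tendsto
      (fun n => (p n : ℝ) * lam n ^ 2 / ((d n : ℝ) * Real.log (d n))) atTop atTop)
    (hε : Tendsto ε atTop (𝓝 0)) :
    ∃ δ : ℕ → ℝ, Tendsto δ atTop (𝓝 0) ∧
      ∀ᶠ n in atTop,
        ∀ (Ω : Type*) [MeasurableSpace Ω] (μ : Measure Ω) [IsProbabilityMeasure μ]
          (W : Ω → Matrix (Fin (p n) × Fin (d n)) (Fin (p n) × Fin (d n)) ℝ)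
          (Zstar : Fin (p n) → Equiv.Perm (Fin (d n)))
          (Z : ℕ → Ω → Fin (p n) → Equiv.Perm (Fin (d n))) (η : ℝ),
          PermSync.IsGaussianNoise W μ →
          (∀ t ω, PermSync.IsStep (PermSync.observation (lam n) Zstar (W ω))
            (Z t ω) (Z (t + 1) ω)) →
          1 - η ≤ μ.real {ω | PermSync.loss (lam n) (Z 0 ω) Zstar ≤
            ε n * ((p n : ℝ) ^ 2 * lam n ^ 2)} →
          1 - η - Real.exp (-Real.sqrt ((p n : ℝ) * lam n ^ 2))
              - Real.exp (-((p n : ℝ) * (d n : ℝ))) ≤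
            μ.real {ω | ∀ t : ℕ, 1 ≤ t →
              PermSync.loss (lam n) (Z t ω) Zstar ≤
                (p n : ℝ) * Real.exp (-((1 + δ n) * ((p n : ℝ) * lam n ^ 2 / 2)))
                  + 1 / 2 * PermSync.loss (lam n) (Z (t - 1) ω) Zstar} := by
  set q : ℕ → ℝ := fun n => (p n : ℝ) * lam n ^ 2 with hq
  set L : ℕ → ℝ := fun n => (d n : ℝ) * Real.log (d n) with hL
  set r : ℕ → ℝ := fun n => q n / L n with hr
  have hrt : Tendsto r atTop atTop := hsnr
  -- For d ≤ 1 the denominator is 0 and the ratio takes the value 0, so divergence forces d ≥ 2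
  -- eventually.
  have hd : ∀ᶠ n in atTop, 2 ≤ d n := by
    filter_upwards [hrt.eventually_ge_atTop 1] with n hn
    by_contra hcon
    have : L n = 0 := by
      have : d n = 0 ∨ d n = 1 := by omega
      rcases this with h | h <;> simp [hL, h]
    simp only [hr, this, div_zero] at hn
    linarith
  have hLr : ∀ᶠ n in atTop, 1 < L n ∧ 1 ≤ r n ∧ q n = r n * L n := by
    filter_upwards [hd, hrt.eventually_ge_atTop 1] with n h1 h2
    have h3 := PermSync.one_lt_mul_log h1
    exact ⟨h3, h2, (div_mul_cancel₀ _ (by positivity)).symm⟩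
  have hqt : Tendsto q atTop atTop := by
    refine tendsto_atTop_mono' _ ?_ hrt
    filter_upwards [hLr] with n ⟨h1, h2, h3⟩
    nlinarith
  -- One term per requirement: the initialization ε ≤ κ, the union bound 768 L ≤ κ² q, and the
  -- invariance of the ball, 2/q ≤ κ.
  set κ : ℕ → ℝ := fun n => max |ε n| (max (Real.sqrt (768 / r n)) (2 / q n)) with hκ
  have hκt : Tendsto κ atTop (𝓝 0) := by
    have h1 : Tendsto (fun n => |ε n|) atTop (𝓝 0) := by simpa using hε.abs
    have h2 : Tendsto (fun n => Real.sqrt (768 / r n)) atTop (𝓝 0) := by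
      simpa using (hrt.const_div_atTop 768).sqrt
    have := h1.max (h2.max (hqt.const_div_atTop 2))
    rwa [max_self, max_self] at this
  have hlogd : Tendsto (fun n => Real.log (2 * d n) / q n) atTop (𝓝 0) := by
    have hinv : Tendsto (fun n => (r n)⁻¹) atTop (𝓝 0) := hrt.inv_tendsto_atTop
    refine squeeze_zero' ?_ ?_ hinv
    · filter_upwards [hLr, hd] with n ⟨h1, h2, h3⟩ h4
      have h5 : (2 : ℝ) ≤ d n := by exact_mod_cast h4
      refine div_nonneg (Real.log_nonneg (by linarith)) ?_
      rw [h3]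
      nlinarith
    · filter_upwards [hLr, hd] with n ⟨h1, h2, h3⟩ h4
      have h5 : (2 : ℝ) ≤ d n := by exact_mod_cast h4
      have h6 := Real.log_le_log two_pos h5
      have h7 : Real.log (2 * d n) ≤ L n := by
        rw [Real.log_mul two_ne_zero (by linarith)]
        have := Real.log_nonneg (by linarith : (1 : ℝ) ≤ d n)
        simp only [hL]
        nlinarith
      have h8 : 0 < r n := by linarith
      rw [h3, div_le_iff₀ (by nlinarith), inv_mul_cancel_left₀ h8.ne']
      exact h7
  have hLq : Tendsto (fun n => L n / q n) atTop (𝓝 0) := by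
    refine hrt.inv_tendsto_atTop.congr fun n => ?_
    simp [hr]
  have hsq : Tendsto (fun n => Real.sqrt (q n) / q n) atTop (𝓝 0) := by
    refine ((Real.tendsto_sqrt_atTop.comp hqt).inv_tendsto_atTop).congr fun n => ?_
    simp [Real.sqrt_div_self']
  have hlogq : Tendsto (fun n => Real.log (q n) / q n) atTop (𝓝 0) := by
    have : Tendsto (fun x : ℝ => Real.log x / x) atTop (𝓝 0) :=
      Real.isLittleO_log_id_atTop.tendsto_div_nhds_zero
    exact this.comp hqt
  -- Obtained by solving (1 + δ) q/2 = a with a the largest value allowed at fixed size. Each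
  -- correction is o(q) because q and q/(d log d) diverge.
  set δ : ℕ → ℝ := fun n => (1 - κ n) ^ 2 - 1 - 2 * (Real.sqrt (q n) / q n) -
    2 * (Real.log (q n) / q n) - 2 * (Real.log (2 * d n) / q n) - 2 * (L n / q n) with hδ
  have hδt : Tendsto δ atTop (𝓝 0) := by
    have := ((((((hκt.const_sub 1).pow 2).sub_const 1).sub (hsq.const_mul 2)).sub
      (hlogq.const_mul 2)).sub (hlogd.const_mul 2)).sub (hLq.const_mul 2)
    simpa using this
  refine ⟨δ, hδt, ?_⟩
  filter_upwards [hLr, hd, hκt.eventually_le_const (by norm_num : (0 : ℝ) < 1 / 2),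
    hδt.eventually_const_le (by norm_num : (-1 : ℝ) < 0)] with n ⟨h1, h2, h3⟩ h4 h5 h6
  intro Ω _ μ _ W Zstar Z η hW hstep hη
  have hqpos : 0 < q n := by rw [h3]; nlinarith
  have hp0 : 0 < p n := by
    refine Nat.pos_of_ne_zero fun h => hqpos.ne' ?_
    simp [hq, h]
  have hlam : lam n ≠ 0 := by
    intro h
    refine hqpos.ne' ?_
    simp [hq, h]
  have hκ0 : 0 ≤ κ n := (abs_nonneg _).trans (le_max_left _ _)
  refine hW.one_sub_le_measure_contraction hp0 h4 hlam hκ0 h5 ?_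
    ((le_max_right _ _).trans (le_max_right _ _)) ?_ ?_
    ((le_abs_self _).trans (le_max_left _ _)) hstep hη
  · have hrpos : 0 < r n := by linarith
    have h7 : 768 / r n ≤ κ n ^ 2 := by
      rw [← Real.sq_sqrt (by positivity : 0 ≤ 768 / r n)]
      exact pow_le_pow_left₀ (Real.sqrt_nonneg _)
        ((le_max_left _ _).trans (le_max_right _ _)) 2
    calc 768 * L n = 768 / r n * q n := by rw [h3]; field_simp
      _ ≤ κ n ^ 2 * q n := mul_le_mul_of_nonneg_right h7 hqpos.le
  -- Nonnegativity of a, from δ ≥ -1.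
  · exact mul_nonneg (by linarith) (by linarith)
  · refine le_of_eq ?_
    change (1 + δ n) * (q n / 2) = (1 - κ n) ^ 2 * q n / 2 - Real.sqrt (q n) -
      Real.log (q n) - Real.log (2 * d n) - L n
    simp only [hδ]
    generalize q n = x at hqpos ⊢
    field_simp
    ring
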